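/- Let $\varphi:\mathcal X\times\mathcal X\to\mathbb R$ be a positive (semi-definite) kernel, $n\ge 1$, and $x_1,\dots,x_n\in\mathcal X$ with $K_{ii}>0$ for all $i$, where $K_{ij}=\varphi(x_i,x_j)$. Let $G\in\mathbb R^{n\times n}$, $G_{ij}=\frac1n\frac{K_{ij}}{\sqrt{K_{ii}K_{jj}}}$, be the normalized kernel matrix, with eigenvalues $\lambda_1,\dots,\lambda_n\ge 0$, largest eigenvalue $\lambda_{\max}$, smallest eigenvalue $\lambda_{\min}$, and $\kappa=\lambda_{\max}/\lambda_{\min}$ if $\lambda_{\min}>0$. For real $\alpha>0$, $\alpha\ne1$ (in particular for every fractional $\alpha>0$), let $$\mathbf S_\alpha(G)=\frac1{1-\alpha}\log_2\Big(\sum_{i=1}^n\lambda_i^\alpha\Big)=\frac1{1-\alpha}\log_2\operatorname{tr}(G^\alpha).$$ Let $0<\epsilon<\frac13$, $0<\delta<1$, $s=\lceil 8\ln(2/\delta)/\epsilon^2\rceil$ and $$m=\left\lceil\alpha+\begin{cases}\sqrt{\kappa}\left(\dfrac{\Gamma(\alpha+\frac12)\Gamma(\alpha)}{\epsilon\,\pi^{3/2}}\right)^{1/(2\alpha)}&\text{if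 }\lambda_{\min}>0,\\[2ex]\left(\dfrac{n\,\Gamma(\alpha+\frac12)\Gamma(\alpha)}{\epsilon\,\pi^{3/2}}\right)^{1/(2\alpha)}&\text{if }\lambda_{\min}=0.\end{cases}\right\rceil$$ For $k\ge0$ put $$c_k=\frac{2\lambda_{\max}^\alpha\,\Gamma(\alpha+\frac12)\,(\alpha)_k}{\sqrt\pi\,\Gamma(\alpha+1)\,(\alpha+k)_k},\qquad (a)_k=a(a-1)\cdots(a-k+1),$$ the Chebyshev coefficients of $x^\alpha$ on $[0,\lambda_{\max}]$. Let $\mathbf g_1,\dots,\mathbf g_s$ be independent standard Gaussian random vectors in $\mathbb R^n$. For each $i$ run Clenshaw's recurrence: $\mathbf y_{m+2}=\mathbf y_{m+1}=\mathbf 0$ and $$\mathbf y_k=c_k\mathbf g_i+\tfrac{4}{\lambda_{\max}}G\mathbf y_{k+1}-2\mathbf y_{k+1}-\mathbf y_{k+2},\qquad k=m,m-1,\dots,0,$$ and set $F_i(G)=\frac12\mathbf g_i^\top(\mathbf y_0-\mathbf y_2)$; this equals $\mathbf g_i^\top f_m(G)\mathbf g_i$, where $f_m(x)=\frac{c_0}2+\sum_{k=1}^m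 c_kT_k\big(\tfrac{2x}{\lambda_{\max}}-1\big)$ and $T_k$ is the $k$-th Chebyshev polynomial of the first kind. The algorithm returns $$\tilde{\mathbf S}_\alpha(G)=\frac1{1-\alpha}\log_2\Big(\frac1s\sum_{i=1}^sF_i(G)\Big).$$ Then, with probability at least $1-\delta$, one has $\frac1s\sum_{i=1}^sF_i(G)>0$ (so that the output is well defined) and $$\big|\mathbf S_\alpha(G)-\tilde{\mathbf S}_\alpha(G)\big|\le\left|\frac1{1-\alpha}\log_2(1-3\epsilon)\right|.$$ -/

import Mathlib

open scoped Matrix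

noncomputable section

namespace RenyiChebyshev

/-- A real-valued positive (semi-definite) kernel: all its Gram matrices are symmetric PSD. -/
def IsPositiveKernel {X : Type*} (φ : X → X → ℝ) : Prop :=
  ∀ (N : ℕ) (z : Fin N → X), (Matrix.of fun i j => φ (z i) (z j)).PosSemidef

/-- The normalized kernel matrix `G i j = (1 / n) * K i j / √(K i i * K j j)`, where
`K i j = φ (x i) (x j)`. -/
def normalizedKernelMatrix {X : Type*} {n : ℕ} (φ : X → X → ℝ) (x : Fin n → X) :
    Matrix (Fin n) (Fin n) ℝ :=
  Matrix.of fun i j =>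
    1 / (n : ℝ) * (φ (x i) (x j) / √(φ (x i) (x i) * φ (x j) (x j)))

theorem IsPositiveKernel.isHermitian {X : Type*} {n : ℕ} {φ : X → X → ℝ}
    (hφ : IsPositiveKernel φ) (x : Fin n → X) : (normalizedKernelMatrix φ x).IsHermitian := by
  ext i j
  have h : φ (x j) (x i) = φ (x i) (x j) := by
    simpa using (hφ n x).isHermitian.apply i j
  simp [normalizedKernelMatrix, h, mul_comm (φ (x j) (x j))]

/-- The matrix-based Rényi entropy
`S_α(G) = 1 / (1 - α) * log₂ (tr (G ^ α)) = 1 / (1 - α) * log₂ (∑ i, λ_i(G) ^ α)`. -/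
def entropy {n : ℕ} {G : Matrix (Fin n) (Fin n) ℝ} (hG : G.IsHermitian) (α : ℝ) : ℝ :=
  1 / (1 - α) * Real.logb 2 (∑ i, hG.eigenvalues i ^ α)

/-- The largest eigenvalue. -/
def lambdaMax {n : ℕ} {G : Matrix (Fin n) (Fin n) ℝ} (hG : G.IsHermitian) : ℝ :=
  ⨆ i, hG.eigenvalues i

/-- The smallest eigenvalue. -/
def lambdaMin {n : ℕ} {G : Matrix (Fin n) (Fin n) ℝ} (hG : G.IsHermitian) : ℝ :=
  ⨅ i, hG.eigenvalues i

/-- The condition number `κ = λ_max / λ_min`. -/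
def condNumber {n : ℕ} {G : Matrix (Fin n) (Fin n) ℝ} (hG : G.IsHermitian) : ℝ :=
  lambdaMax hG / lambdaMin hG

/-- The falling factorial `(a)_k = a (a - 1) ⋯ (a - k + 1)`. -/
def fallingFactorial (a : ℝ) (k : ℕ) : ℝ := (descPochhammer ℝ k).eval a

/-- The Chebyshev coefficients of `x ^ α` on `[0, lam]`. -/
def chebCoeff (α lam : ℝ) (k : ℕ) : ℝ :=
  2 * lam ^ α * Real.Gamma (α + 1 / 2) * fallingFactorial α k /
    (√Real.pi * Real.Gamma (α + 1) * fallingFactorial (α + k) k)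

/-- The vectors of Clenshaw's recurrence for coefficients `c 0, …, c m`: `y (m+2) = y (m+1) = 0`
and `y k = c k g + 4 G y (k+1) / lam - 2 y (k+1) - y (k+2)` for `k = m, m-1, …, 0`. -/
def clenshaw {n : ℕ} (c : ℕ → ℝ) (lam : ℝ) (G : Matrix (Fin n) (Fin n) ℝ) (g : Fin n → ℝ)
    (m k : ℕ) : Fin n → ℝ :=
  if m < k then 0
  else c k • g + (4 / lam) • (G *ᵥ clenshaw c lam G g m (k + 1))
    - (2 : ℝ) • clenshaw c lam G g m (k + 1) - clenshaw c lam G g m (k + 2)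
termination_by m + 1 - k

/-- The quadratic form `F(G) = gᵀ f_m(G) g`, computed from Clenshaw's vectors as
`gᵀ (y 0 - y 2) / 2`, where `f_m = c 0 / 2 + ∑ k ∈ [1, m], c k T_k`; see `clenshawForm_eq`. -/
def clenshawForm {n : ℕ} (c : ℕ → ℝ) (lam : ℝ) (G : Matrix (Fin n) (Fin n) ℝ) (m : ℕ)
    (g : Fin n → ℝ) : ℝ :=
  g ⬝ᵥ (clenshaw c lam G g m 0 - clenshaw c lam G g m 2) / 2

/-- `f_m(G) = c 0 / 2 + ∑ k ∈ [1, m], c k T_k (2 G / lam - 1)`. -/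
def chebSum {n : ℕ} (c : ℕ → ℝ) (lam : ℝ) (G : Matrix (Fin n) (Fin n) ℝ) (m : ℕ) :
    Matrix (Fin n) (Fin n) ℝ :=
  (c 0 / 2) • 1 + ∑ k ∈ Finset.Icc 1 m,
    c k • Polynomial.aeval ((2 / lam) • G - 1) (Polynomial.Chebyshev.T ℝ (k : ℤ))

/-- Clenshaw's recurrence evaluates the quadratic form of the truncated Chebyshev series. -/
theorem clenshawForm_eq {n : ℕ} (c : ℕ → ℝ) (lam : ℝ) (G : Matrix (Fin n) (Fin n) ℝ) (m : ℕ)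
    (g : Fin n → ℝ) : clenshawForm c lam G m g = g ⬝ᵥ (chebSum c lam G m *ᵥ g) := by
  set B : Matrix (Fin n) (Fin n) ℝ := (2 / lam) • G - 1 with hB
  set y := clenshaw c lam G g m with hy
  have hzero : ∀ k, m < k → y k = 0 := fun k hk => by rw [hy, clenshaw, if_pos hk]
  have hrec : ∀ k, k ≤ m → y k = c k • g + (2 : ℝ) • (B *ᵥ y (k + 1)) - y (k + 2) := by
    intro k hk
    rw [hy, clenshaw, if_neg (not_lt.mpr hk), ← hy, hB, Matrix.sub_mulVec, Matrix.smul_mulVec,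
      Matrix.one_mulVec, smul_sub, smul_smul]
    have : (2 : ℝ) * (2 / lam) = 4 / lam := by ring
    rw [this]
    abel
  have hT : ∀ k : ℕ, Polynomial.aeval B (Polynomial.Chebyshev.T ℝ ((k + 2 : ℕ) : ℤ)) =
      (2 : ℝ) • (Polynomial.aeval B (Polynomial.Chebyshev.T ℝ ((k + 1 : ℕ) : ℤ)) * B)
        - Polynomial.aeval B (Polynomial.Chebyshev.T ℝ (k : ℤ)) := by
    intro k
    push_cast
    rw [Polynomial.Chebyshev.T_add_two, mul_assoc, mul_comm Polynomial.X]
    simp [two_mul, two_smul]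
  have key : ∀ j k : ℕ, k + j = m →
      ∑ i ∈ Finset.Icc (k + 1) m,
        (c i • Polynomial.aeval B (Polynomial.Chebyshev.T ℝ (i : ℤ))) *ᵥ g =
      Polynomial.aeval B (Polynomial.Chebyshev.T ℝ ((k + 1 : ℕ) : ℤ)) *ᵥ y (k + 1)
        - Polynomial.aeval B (Polynomial.Chebyshev.T ℝ (k : ℤ)) *ᵥ y (k + 2) := by
    intro j
    induction j with
    | zero =>
      intro k hk
      rw [Finset.Icc_eq_empty (by omega), hzero (k + 1) (by omega), hzero (k + 2) (by omega)]
      simp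
    | succ j ih =>
      intro k hk
      rw [← Finset.add_sum_Ioc_eq_sum_Icc (by omega), ← Finset.Icc_add_one_left_eq_Ioc,
        ih (k + 1) (by omega), hrec (k + 1) (by omega), hT k]
      simp only [Matrix.sub_mulVec, Matrix.smul_mulVec, Matrix.mulVec_sub, Matrix.mulVec_add,
        Matrix.mulVec_smul, Matrix.mulVec_mulVec, add_assoc, Nat.reduceAdd]
      abel
  have h0 := key m 0 (by omega)
  rw [clenshawForm, ← hy, hrec 0 (by omega), chebSum, ← hB, Matrix.add_mulVec,
    Matrix.sum_mulVec]
  simp only [zero_add] at h0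
  rw [h0]
  simp only [Nat.cast_zero, Nat.cast_one, Polynomial.Chebyshev.T_one, Polynomial.Chebyshev.T_zero,
    Polynomial.aeval_X, map_one, Matrix.one_mulVec, Matrix.smul_mulVec, zero_add,
    dotProduct_sub, dotProduct_add, dotProduct_smul, smul_eq_mul]
  ring

/-- The randomized estimate `(1 / s) ∑ i, F_i(G)` of `tr (G ^ α)` from query vectors `g i`. -/
def traceEstimate {n : ℕ} {G : Matrix (Fin n) (Fin n) ℝ} (hG : G.IsHermitian) (α : ℝ)
    (s m : ℕ) (g : Fin s → EuclideanSpace ℝ (Fin n)) : ℝ :=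
  1 / (s : ℝ) * ∑ i, clenshawForm (chebCoeff α (lambdaMax hG)) (lambdaMax hG) G m (g i).ofLp

/-- The output of the algorithm, `1 / (1 - α) * log₂ ((1 / s) ∑ i, F_i(G))`. -/
def entropyEstimate {n : ℕ} {G : Matrix (Fin n) (Fin n) ℝ} (hG : G.IsHermitian) (α : ℝ)
    (s m : ℕ) (g : Fin s → EuclideanSpace ℝ (Fin n)) : ℝ :=
  1 / (1 - α) * Real.logb 2 (traceEstimate hG α s m g)

/-- The number of query vectors, `⌈8 ln(2 / δ) / ε ^ 2⌉`. -/
def numVectors (ε δ : ℝ) : ℕ := ⌈8 * Real.log (2 / δ) / ε ^ 2⌉₊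

/-- The degree of the Chebyshev series. -/
def chebDegree {n : ℕ} {G : Matrix (Fin n) (Fin n) ℝ} (hG : G.IsHermitian) (α ε : ℝ) : ℕ :=
  ⌈α + if 0 < lambdaMin hG then
      √(condNumber hG) * (Real.Gamma (α + 1 / 2) * Real.Gamma α /
        (ε * Real.pi ^ (3 / 2 : ℝ))) ^ (1 / (2 * α))
    else
      ((n : ℝ) * Real.Gamma (α + 1 / 2) * Real.Gamma α /
        (ε * Real.pi ^ (3 / 2 : ℝ))) ^ (1 / (2 * α))⌉₊

end RenyiChebyshev

end

/-!
Clenshaw's recurrence computes `gᵀ f_m(G) g`, and for a standard Gaussian `g` this is a weighted sum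
of independent squared standard normals, the weights being the eigenvalues `f_m(λ_i)` of `f_m(G)`.
Two errors have to be controlled, relative to `T = ∑ λ_i ^ α`.

*Bias.* Substituting `x = λ_max (1 + cos θ) / 2` turns the Chebyshev expansion of `x ^ α` into the
cosine series of an even continuous function. Its coefficients follow from a two-term recurrence
that starts at a Beta integral. Beyond `α` they alternate in sign and their absolute values
telescope, so the tail after `m` is explicit; the reflection formula and log-convexity of `Γ` bound
it by `λ_max ^ α Γ(α + 1/2) Γ(α) / (π ^ (3/2) (m - α) ^ (2 α))`. The degree is chosen so that `n`
times this is at most `ε T`, because `T ≥ n λ_min ^ α` and `T ≥ λ_max ^ α`.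

*Fluctuation.* As `∑ |f_m(λ_i)| ≤ (1 + ε) T`, Chernoff's bound with the explicit moment generating
function `∏ (1 - 2 t f_m(λ_i)) ^ (-1/2)` shows that the mean of `s` samples deviates from its
expectation by `ε (1 + ε) T` with probability at most `2 exp (-s ε ^ 2 / 8) ≤ δ`.

Together the estimate is within `3 ε T` of `T`, and `(1 - 3 ε) (1 + 3 ε) ≤ 1` makes the logarithmic
error two-sided.
-/

namespace RenyiChebyshev

section Coefficients

open Real

theorem fallingFactorial_zero (a : ℝ) : fallingFactorial a 0 = 1 := by
  simp [fallingFactorial]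

theorem fallingFactorial_succ (a : ℝ) (k : ℕ) :
    fallingFactorial a (k + 1) = fallingFactorial a k * (a - k) := by
  simp [fallingFactorial, descPochhammer_succ_right]

theorem fallingFactorial_add_one_succ (a : ℝ) (k : ℕ) :
    fallingFactorial (a + 1) (k + 1) = (a + 1) * fallingFactorial a k := by
  simp [fallingFactorial, descPochhammer_succ_left]

theorem fallingFactorial_mul_Gamma {a : ℝ} {k : ℕ} (ha : ∀ j < k, a ≠ j) :
    fallingFactorial a k * Gamma (a + 1 - k) = Gamma (a + 1) := by
  induction k with
  | zero => simp [fallingFactorial_zero]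
  | succ k ih =>
    have hk : a - k ≠ 0 := sub_ne_zero.2 (ha k k.lt_succ_self)
    rw [← ih fun j hj => ha j (hj.trans k.lt_succ_self), fallingFactorial_succ, mul_assoc,
      add_sub_right_comm a 1 (k : ℝ), Gamma_add_one hk]
    push_cast
    ring_nf

theorem fallingFactorial_add_natCast_mul_Gamma {a : ℝ} (ha : -1 < a) (k : ℕ) :
    fallingFactorial (a + k) k * Gamma (a + 1) = Gamma (a + k + 1) := by
  have h : ∀ j < k, a + k ≠ j := fun j hj => by
    have : (j : ℝ) + 1 ≤ k := by exact_mod_cast hj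
    linarith
  rw [← fallingFactorial_mul_Gamma h, add_right_comm, add_sub_cancel_right]

theorem fallingFactorial_mul_pi {a : ℝ} (ha : -1 < a) {k : ℕ} (hk : a < k) :
    fallingFactorial a k * π = Gamma (a + 1) * Gamma (k - a) * sin (π * (a + 1 - k)) := by
  by_cases hj : ∃ j < k, a = j
  · obtain ⟨j, hjk, rfl⟩ := hj
    have hsin : sin (π * (j + 1 - k)) = 0 := by
      rw [mul_comm]
      exact_mod_cast sin_int_mul_pi (j + 1 - k)
    rw [fallingFactorial, descPochhammer_eval_coe_nat_of_lt hjk, hsin, zero_mul, mul_zero]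
  · push Not at hj
    have hfall := fallingFactorial_mul_Gamma hj
    have hrefl := Gamma_mul_Gamma_one_sub (a + 1 - k)
    have hΓ : Gamma (a + 1 - k) ≠ 0 := by
      refine right_ne_zero_of_mul (a := fallingFactorial a k) ?_
      rw [hfall]
      exact (Gamma_pos_of_pos (by linarith)).ne'
    rw [show 1 - (a + 1 - k) = k - a by ring] at hrefl
    have hsin : sin (π * (a + 1 - k)) ≠ 0 := fun h => by
      rw [h, div_zero] at hrefl
      exact mul_ne_zero hΓ (Gamma_pos_of_pos (by linarith)).ne' hrefl
    rw [eq_div_iff hsin] at hrefl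
    rw [← hfall, mul_assoc, mul_assoc, ← mul_assoc (Gamma (a + 1 - k)), hrefl]

theorem abs_fallingFactorial_le {a : ℝ} (ha : -1 < a) {k : ℕ} (hk : a < k) :
    |fallingFactorial a k| ≤ Gamma (a + 1) * Gamma (k - a) / π := by
  have h₁ : 0 < Gamma (a + 1) := Gamma_pos_of_pos (by linarith)
  have h₂ : 0 < Gamma (k - a) := Gamma_pos_of_pos (by linarith)
  have h := congrArg abs (fallingFactorial_mul_pi ha hk)
  rw [abs_mul, abs_of_pos pi_pos, abs_mul, abs_of_pos (mul_pos h₁ h₂)] at h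
  rw [le_div_iff₀ pi_pos, h]
  exact mul_le_of_le_one_right (mul_pos h₁ h₂).le (abs_sin_le_one _)

/-- A Gautschi-type bound: the slopes of `log ∘ Γ` increase. -/
theorem rpow_mul_Gamma_add_one_le {y b : ℝ} (hy : 0 < y) (hb : 0 < b) :
    y ^ b * Gamma (y + 1) ≤ Gamma (y + 1 + b) := by
  have h₀ : 0 < Gamma y := Gamma_pos_of_pos hy
  have h₁ : 0 < Gamma (y + 1) := Gamma_pos_of_pos (by linarith)
  have h₂ : 0 < Gamma (y + 1 + b) := Gamma_pos_of_pos (by linarith)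
  have hlog : log (Gamma (y + 1)) - log (Gamma y) = log y := by
    rw [Gamma_add_one hy.ne', log_mul hy.ne' h₀.ne', add_sub_cancel_right]
  have hslope : log y ≤ (log (Gamma (y + 1 + b)) - log (Gamma (y + 1))) / b := by
    have h := convexOn_log_Gamma.slope_mono_adjacent (Set.mem_Ioi.2 hy)
      (Set.mem_Ioi.2 (by linarith : 0 < y + 1 + b)) (lt_add_one y) (lt_add_of_pos_right _ hb)
    simpa only [Function.comp_apply, add_sub_cancel_left, div_one, hlog] using h
  rw [le_div_iff₀ hb] at hslope
  rw [← log_le_log_iff (by positivity) h₂, log_mul (by positivity) h₁.ne', log_rpow hy]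
  linarith

theorem chebCoeff_eq_rpow_mul (α lam : ℝ) (k : ℕ) :
    chebCoeff α lam k = lam ^ α * chebCoeff α 1 k := by
  simp only [chebCoeff, one_rpow]
  ring

theorem chebCoeff_succ {α : ℝ} (hα : -1 < α) (lam : ℝ) (k : ℕ) :
    (α + k + 1) * chebCoeff α lam (k + 1) = (α - k) * chebCoeff α lam k := by
  have : (0 : ℝ) ≤ k := k.cast_nonneg
  have h₁ : α + k + 1 ≠ 0 := by linarith
  have hfall : fallingFactorial (α + (k + 1 : ℕ)) (k + 1) =
      (α + k + 1) * fallingFactorial (α + k) k := by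
    rw [← fallingFactorial_add_one_succ]
    push_cast
    ring_nf
  rw [chebCoeff, chebCoeff, hfall, fallingFactorial_succ]
  field_simp

theorem abs_chebCoeff_succ {α : ℝ} (hα : -1 < α) (lam : ℝ) {k : ℕ} (hk : α ≤ k) :
    (α + k + 1) * |chebCoeff α lam (k + 1)| = (k - α) * |chebCoeff α lam k| := by
  have : (0 : ℝ) ≤ k := k.cast_nonneg
  have h := congrArg abs (chebCoeff_succ hα lam k)
  rwa [abs_mul, abs_mul, abs_of_nonneg (by linarith : 0 ≤ α + k + 1),
    abs_of_nonpos (sub_nonpos.2 hk), neg_sub] at h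

theorem sum_abs_chebCoeff {α : ℝ} (hα : -1 < α) (lam : ℝ) {m : ℕ} (hm : α ≤ m) (N : ℕ) :
    2 * α * ∑ i ∈ Finset.range N, |chebCoeff α lam (i + (m + 1))| =
      (m - α) * |chebCoeff α lam m| - ((N + m : ℕ) - α) * |chebCoeff α lam (N + m)| := by
  have htel (i : ℕ) : 2 * α * |chebCoeff α lam (i + (m + 1))| =
      ((i + m : ℕ) - α) * |chebCoeff α lam (i + m)| -
        ((i + 1 + m : ℕ) - α) * |chebCoeff α lam (i + 1 + m)| := by
    have h := abs_chebCoeff_succ hα lam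
      (hm.trans (Nat.cast_le.2 (Nat.le_add_left m i)) : α ≤ (i + m : ℕ))
    rw [add_assoc i 1 m, add_comm 1 m, ← h, ← add_assoc i m 1]
    push_cast
    ring
  rw [Finset.mul_sum, Finset.sum_congr rfl fun i _ => htel i,
    Finset.sum_range_sub' (fun i : ℕ => ((i + m : ℕ) - α) * |chebCoeff α lam (i + m)|), zero_add]

theorem sum_abs_chebCoeff_le {α : ℝ} (hα : 0 < α) (lam : ℝ) {m : ℕ} (hm : α ≤ m) (N : ℕ) :
    ∑ i ∈ Finset.range N, |chebCoeff α lam (i + (m + 1))| ≤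
      (m - α) * |chebCoeff α lam m| / (2 * α) := by
  have hN : α ≤ (N + m : ℕ) := hm.trans (Nat.cast_le.2 (Nat.le_add_left m N))
  rw [le_div_iff₀' (by positivity), sum_abs_chebCoeff (by linarith) lam hm N]
  exact sub_le_self _ (mul_nonneg (sub_nonneg.2 hN) (abs_nonneg _))

theorem summable_abs_chebCoeff {α : ℝ} (hα : 0 < α) (lam : ℝ) :
    Summable fun k => |chebCoeff α lam k| := by
  obtain ⟨m, hm⟩ := exists_nat_ge α
  rw [← summable_nat_add_iff (m + 1)]
  exact summable_of_sum_range_le (fun _ => abs_nonneg _) (sum_abs_chebCoeff_le hα lam hm)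

/-- The constant `Γ(α + 1/2) Γ(α) / π ^ (3/2)` of the tail bound
`∑_{k > m} |c_k| ≤ λ ^ α * tailConst α / (m - α) ^ (2 α)` for the Chebyshev coefficients `c_k` of
`x ^ α` on `[0, λ]`. -/
noncomputable def tailConst (α : ℝ) : ℝ :=
  Gamma (α + 1 / 2) * Gamma α / π ^ (3 / 2 : ℝ)

theorem tailConst_pos {α : ℝ} (hα : 0 < α) : 0 < tailConst α := by
  have : 0 < Gamma (α + 1 / 2) := Gamma_pos_of_pos (by positivity)
  have : 0 < Gamma α := Gamma_pos_of_pos hα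
  unfold tailConst
  positivity

theorem abs_chebCoeff_le {α lam : ℝ} (hα : 0 < α) (hlam : 0 ≤ lam) {k : ℕ} (hk : α < k) :
    |chebCoeff α lam k| ≤
      2 * α * (lam ^ α * tailConst α) * (Gamma (k - α) / Gamma (α + k + 1)) := by
  have : 0 < Gamma (α + 1) := Gamma_pos_of_pos (by positivity)
  have : 0 < Gamma (α + 1 / 2) := Gamma_pos_of_pos (by positivity)
  have : 0 < Gamma (α + k + 1) := Gamma_pos_of_pos (by positivity)
  have hpi : π ^ (3 / 2 : ℝ) = √π * π := by
    rw [sqrt_eq_rpow, ← rpow_add_one pi_ne_zero]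
    norm_num
  have hnum : 0 ≤ 2 * lam ^ α * Gamma (α + 1 / 2) := by positivity
  calc |chebCoeff α lam k|
      = 2 * lam ^ α * Gamma (α + 1 / 2) * |fallingFactorial α k| / (√π * Gamma (α + k + 1)) := by
        rw [chebCoeff, mul_assoc √π, mul_comm (Gamma (α + 1)),
          fallingFactorial_add_natCast_mul_Gamma (by linarith), abs_div, abs_mul,
          abs_of_nonneg hnum, abs_of_pos (by positivity : 0 < √π * Gamma (α + k + 1))]
    _ ≤ 2 * lam ^ α * Gamma (α + 1 / 2) * (Gamma (α + 1) * Gamma (k - α) / π) /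
          (√π * Gamma (α + k + 1)) := by
        gcongr
        exact abs_fallingFactorial_le (by linarith) hk
    _ = 2 * α * (lam ^ α * tailConst α) * (Gamma (k - α) / Gamma (α + k + 1)) := by
        rw [Gamma_add_one hα.ne', tailConst, hpi]
        field_simp

theorem tsum_abs_chebCoeff_le {α lam : ℝ} (hα : 0 < α) (hlam : 0 ≤ lam) {m : ℕ} (hm : α < m) :
    ∑' i, |chebCoeff α lam (i + (m + 1))| ≤ lam ^ α * tailConst α / (m - α) ^ (2 * α) := by
  have hy : 0 < m - α := sub_pos.2 hm
  have hΓ : 0 < Gamma (α + m + 1) := Gamma_pos_of_pos (by positivity)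
  have hC := tailConst_pos hα
  have hgautschi : (m - α) ^ (2 * α) * Gamma (m - α + 1) ≤ Gamma (α + m + 1) := by
    convert rpow_mul_Gamma_add_one_le hy (show 0 < 2 * α by positivity) using 2
    ring
  calc ∑' i, |chebCoeff α lam (i + (m + 1))|
      ≤ (m - α) * |chebCoeff α lam m| / (2 * α) :=
        Real.tsum_le_of_sum_range_le (fun _ => abs_nonneg _) (sum_abs_chebCoeff_le hα lam hm.le)
    _ ≤ (m - α) * (2 * α * (lam ^ α * tailConst α) * (Gamma (m - α) / Gamma (α + m + 1))) /
          (2 * α) := by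
        gcongr
        exact abs_chebCoeff_le hα hlam hm
    _ = lam ^ α * tailConst α * (Gamma (m - α + 1) / Gamma (α + m + 1)) := by
        rw [Gamma_add_one hy.ne']
        field_simp
    _ ≤ lam ^ α * tailConst α * (1 / (m - α) ^ (2 * α)) := by
        gcongr ?_ * ?_
        rw [div_le_div_iff₀ hΓ (by positivity)]
        linarith
    _ = lam ^ α * tailConst α / (m - α) ^ (2 * α) := mul_one_div _ _

end Coefficients

section Integrals

open Real Polynomial Polynomial.Chebyshev intervalIntegral

theorem integral_rpow_mul_one_sub_rpow {a b : ℝ} (ha : 0 < a) (hb : 0 < b) :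
    ∫ x in (0 : ℝ)..1, x ^ (a - 1) * (1 - x) ^ (b - 1) = ProbabilityTheory.beta a b := by
  suffices h : Complex.betaIntegral a b =
      ((∫ x in (0 : ℝ)..1, x ^ (a - 1) * (1 - x) ^ (b - 1) : ℝ) : ℂ) by
    rw [ProbabilityTheory.beta_eq_betaIntegralReal a b ha hb, h, Complex.ofReal_re]
  rw [Complex.betaIntegral, ← intervalIntegral.integral_ofReal]
  refine intervalIntegral.integral_congr fun x hx => ?_
  rw [Set.uIcc_of_le zero_le_one] at hx
  rw [Complex.ofReal_mul, Complex.ofReal_cpow hx.1, Complex.ofReal_cpow (sub_nonneg.2 hx.2)]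
  push_cast
  rfl

theorem integral_half_one_add_rpow_measureT {α : ℝ} (hα : -(1 / 2) < α) :
    ∫ x, ((1 + x) / 2) ^ α ∂measureT = √π * Gamma (α + 1 / 2) / Gamma (α + 1) := by
  have hpt : (Set.Ioo (0 : ℝ) 1).EqOn
      (fun y => ((1 + (2 * y - 1)) / 2) ^ α * √(1 - (2 * y - 1) ^ 2)⁻¹)
      (fun y => 2⁻¹ * (y ^ (α + 1 / 2 - 1) * (1 - y) ^ ((1 / 2 : ℝ) - 1))) := by
    intro y hy
    have h₁ : 0 < y := hy.1
    have h₂ : 0 < 1 - y := sub_pos.2 hy.2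
    have hsqrt : √(1 - (2 * y - 1) ^ 2)⁻¹ =
        2⁻¹ * (y ^ (-(1 / 2) : ℝ) * (1 - y) ^ (-(1 / 2) : ℝ)) := by
      rw [show 1 - (2 * y - 1) ^ 2 = 2 ^ 2 * (y * (1 - y)) by ring, sqrt_inv,
        sqrt_mul (by norm_num), sqrt_sq zero_le_two, ← mul_rpow h₁.le h₂.le,
        rpow_neg (by positivity), ← sqrt_eq_rpow, mul_inv]
    dsimp only
    rw [hsqrt, show (1 + (2 * y - 1)) / 2 = y by ring,
      show α + 1 / 2 - 1 = α + -(1 / 2) by ring, rpow_add h₁]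
    norm_num
    ring
  have hsubst := smul_integral_comp_mul_sub (a := 0) (b := 1)
    (fun x : ℝ => ((1 + x) / 2) ^ α * √(1 - x ^ 2)⁻¹) 2 1
  rw [mul_zero, zero_sub, mul_one, show (2 : ℝ) - 1 = 1 by norm_num,
    integral_congr_Ioo_of_le zero_le_one hpt, integral_const_mul,
    integral_rpow_mul_one_sub_rpow (by linarith) one_half_pos] at hsubst
  rw [integral_measureT, ← hsubst, smul_eq_mul, mul_inv_cancel_left₀ two_ne_zero,
    ProbabilityTheory.beta, Gamma_one_half_eq, add_assoc, add_halves, mul_comm √π]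

theorem integral_half_one_add_cos_rpow_mul_cos_succ {α : ℝ} (hα : 0 ≤ α) (k : ℕ) :
    (α + k + 1) * ∫ θ in (0 : ℝ)..π, ((1 + cos θ) / 2) ^ α * cos ((k + 1 : ℕ) * θ) =
      (α - k) * ∫ θ in (0 : ℝ)..π, ((1 + cos θ) / 2) ^ α * cos (k * θ) := by
  have hw : Continuous fun θ => ((1 + cos θ) / 2) ^ α :=
    (by fun_prop : Continuous fun θ => (1 + cos θ) / 2).rpow_const fun _ => Or.inr hα
  have hint (r : ℝ) (j : ℕ) : IntervalIntegrable
      (fun θ => r * (((1 + cos θ) / 2) ^ α * cos (j * θ))) MeasureTheory.volume 0 π :=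
    (continuous_const.mul (hw.mul (by fun_prop))).intervalIntegrable _ _
  have hderiv : ∀ θ ∈ Set.Ioo (0 : ℝ) π, HasDerivAt
      (fun θ => ((1 + cos θ) / 2) ^ α * (sin ((k + 1 : ℕ) * θ) + sin (k * θ)))
      ((α + k + 1) * (((1 + cos θ) / 2) ^ α * cos ((k + 1 : ℕ) * θ)) -
        (α - k) * (((1 + cos θ) / 2) ^ α * cos (k * θ))) θ := by
    intro θ hθ
    have hcos : 0 < 1 + cos θ := by
      linarith [cos_pi, strictAntiOn_cos ⟨hθ.1.le, hθ.2.le⟩ (Set.right_mem_Icc.2 pi_pos.le) hθ.2]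
    have hsin : sin θ * (sin ((k + 1 : ℕ) * θ) + sin (k * θ)) =
        (1 + cos θ) * (cos (k * θ) - cos ((k + 1 : ℕ) * θ)) := by
      push_cast
      rw [add_one_mul, sin_add, cos_add]
      linear_combination cos (k * θ) * sin_sq_add_cos_sq θ
    have hw' := (((hasDerivAt_cos θ).const_add 1).div_const 2).rpow_const (p := α)
      (Or.inl (half_pos hcos).ne')
    have hS' (j : ℕ) : HasDerivAt (fun θ => sin (j * θ)) (j * cos (j * θ)) θ := by
      simpa [mul_comm] using ((hasDerivAt_id θ).const_mul (j : ℝ)).sin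
    refine (hw'.mul ((hS' (k + 1)).add (hS' k))).congr_deriv ?_
    rw [rpow_sub_one (half_pos hcos).ne']
    simp only [Pi.add_apply]
    field_simp
    push_cast at hsin ⊢
    rw [mul_comm θ (k : ℝ)]
    linear_combination -α * hsin
  have h := integral_eq_sub_of_hasDerivAt_of_le pi_pos.le (by fun_prop) hderiv
    ((hint _ _).sub (hint _ _))
  rw [intervalIntegral.integral_sub (hint _ _) (hint _ _), integral_const_mul, integral_const_mul,
    sin_nat_mul_pi, sin_nat_mul_pi] at h
  simpa [sub_eq_zero] using h

theorem integral_half_one_add_rpow_mul_T_measureT {α : ℝ} (hα : 0 ≤ α) (k : ℕ) :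
    ∫ x, ((1 + x) / 2) ^ α * (T ℝ k).eval x ∂measureT = π / 2 * chebCoeff α 1 k := by
  induction k with
  | zero =>
    have hπ : √π ^ 2 = π := sq_sqrt pi_pos.le
    simp only [Nat.cast_zero, T_zero, eval_one, mul_one]
    rw [integral_half_one_add_rpow_measureT (by linarith), chebCoeff]
    simp only [fallingFactorial_zero, one_rpow, mul_one]
    field_simp
    rw [hπ]
  | succ k ih =>
    have hk : α + k + 1 ≠ 0 := by positivity
    have h := integral_half_one_add_cos_rpow_mul_cos_succ hα k
    rw [integral_measureT_eq_integral_cos] at ih ⊢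
    simp only [T_real_cos, Int.cast_natCast] at ih ⊢
    refine mul_left_cancel₀ hk ?_
    rw [h, ih, mul_left_comm, ← chebCoeff_succ (by linarith), mul_left_comm]

end Integrals

section Expansion

open Real Polynomial Polynomial.Chebyshev intervalIntegral

theorem fourier_add_fourier_neg {T : ℝ} (n : ℤ) (θ : ℝ) :
    fourier n (θ : AddCircle T) + fourier (-n) (θ : AddCircle T) =
      ((2 * cos (2 * π * n * θ / T) : ℝ) : ℂ) := by
  rw [fourier_coe_apply, fourier_coe_apply, Complex.ofReal_mul, Complex.ofReal_ofNat,
    Complex.ofReal_cos, Complex.two_cos]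
  push_cast
  ring_nf

theorem fourierCoeff_lift_of_even {T : ℝ} [hT : Fact (0 < T)] {h : ℝ → ℝ} (hc : Continuous h)
    (hper : Function.Periodic (fun θ => (h θ : ℂ)) T) (heven : Function.Even h) (n : ℤ) :
    fourierCoeff (T := T) hper.lift n =
      ((2 / T * ∫ θ in (0 : ℝ)..T / 2, h θ * cos (2 * π * n * θ / T) : ℝ) : ℂ) := by
  set F : ℝ → ℂ := fun θ => fourier (-n) (θ : AddCircle T) * h θ with hF
  have hFc : Continuous F := ((fourier (-n)).continuous.comp (AddCircle.continuous_mk' T)).mul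
    (Complex.continuous_ofReal.comp hc)
  have hFint (a b : ℝ) : IntervalIntegrable F MeasureTheory.volume a b :=
    hFc.intervalIntegrable a b
  have hfold (θ : ℝ) : F (-θ) + F θ = ((2 * (h θ * cos (2 * π * n * θ / T)) : ℝ) : ℂ) := by
    simp only [hF, heven θ, AddCircle.coe_neg]
    rw [fourier_apply (n := -n) (x := -_), neg_smul_neg, ← fourier_apply, ← add_mul,
      fourier_add_fourier_neg]
    push_cast
    ring
  have hsplit : ∫ θ in (-(T / 2))..T / 2, F θ = ∫ θ in (0 : ℝ)..T / 2, (F (-θ) + F θ) := by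
    have hneg : IntervalIntegrable (fun θ => F (-θ)) MeasureTheory.volume 0 (T / 2) :=
      (hFc.comp continuous_neg).intervalIntegrable _ _
    rw [integral_add hneg (hFint _ _), integral_comp_neg, neg_zero,
      integral_add_adjacent_intervals (hFint _ _) (hFint _ _)]
  calc fourierCoeff (T := T) hper.lift n
      = (1 / T) • ∫ θ in (-(T / 2))..T / 2, F θ := by
        rw [fourierCoeff_eq_intervalIntegral _ n (-(T / 2)), neg_add_eq_sub, sub_half]
        rfl
    _ = _ := by
        simp only [hsplit, hfold, intervalIntegral.integral_ofReal, integral_const_mul,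
          Complex.real_smul]
        push_cast
        ring

theorem hasSum_mul_cos_of_even {T : ℝ} [hT : Fact (0 < T)] {h : ℝ → ℝ} (hc : Continuous h)
    (hper : Function.Periodic h T) (heven : Function.Even h) {c : ℕ → ℝ} (hsum : Summable c)
    (hcoeff : ∀ k : ℕ, ∫ θ in (0 : ℝ)..T / 2, h θ * cos (2 * π * k * θ / T) = T / 4 * c k)
    (θ : ℝ) : HasSum (fun k : ℕ => c k * cos (2 * π * k * θ / T)) (h θ + c 0 / 2) := by
  have hperC : Function.Periodic (fun θ => (h θ : ℂ)) T := fun θ => congrArg _ (hper θ)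
  let F : C(AddCircle T, ℂ) :=
    ⟨hperC.lift, isQuotientMap_quotient_mk'.continuous_iff.2 (Complex.continuous_ofReal.comp hc)⟩
  have hF (n : ℤ) : fourierCoeff F n = ((c n.natAbs / 2 : ℝ) : ℂ) := by
    have hT₀ : T ≠ 0 := hT.out.ne'
    have hcos (θ : ℝ) : cos (2 * π * n * θ / T) = cos (2 * π * n.natAbs * θ / T) := by
      rw [Nat.cast_natAbs, Int.cast_abs]
      rcases abs_choice (n : ℝ) with hn | hn <;> rw [hn]
      rw [← cos_neg]
      ring_nf
    refine (fourierCoeff_lift_of_even hc hperC heven n).trans ?_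
    simp only [hcos, hcoeff]
    congr 1
    field_simp
    norm_num
  have hFsum : Summable (fourierCoeff F) := by
    have hc' : Summable fun k : ℕ => ((c k / 2 : ℝ) : ℂ) :=
      Complex.ofRealCLM.summable (hsum.div_const 2)
    refine Summable.of_nat_of_neg ?_ ?_ <;>
      simpa only [hF, Int.natAbs_neg, Int.natAbs_natCast] using hc'
  rw [← Complex.hasSum_ofReal]
  convert (has_pointwise_sum_fourier_series_of_summable hFsum (θ : AddCircle T)).nat_add_neg using 1
  · ext k
    simp only [hF, Int.natAbs_natCast, Int.natAbs_neg, smul_eq_mul, ← mul_add,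
      fourier_add_fourier_neg]
    push_cast
    ring
  · rw [hF, Int.natAbs_zero, fourier_zero, smul_eq_mul, mul_one, Complex.ofReal_add]
    rfl

theorem hasSum_mul_T_of_integral_measureT {f : ℝ → ℝ} (hf : ContinuousOn f (Set.Icc (-1) 1))
    {c : ℕ → ℝ} (hsum : Summable c)
    (hcoeff : ∀ k : ℕ, ∫ x, f x * (T ℝ k).eval x ∂measureT = π / 2 * c k)
    {x : ℝ} (hx : x ∈ Set.Icc (-1 : ℝ) 1) :
    HasSum (fun k : ℕ => c k * (T ℝ k).eval x) (f x + c 0 / 2) := by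
  have : Fact (0 < 2 * π) := ⟨two_pi_pos⟩
  have hfcos : Continuous fun θ => f (cos θ) :=
    hf.comp_continuous continuous_cos cos_mem_Icc
  have hangle (k θ : ℝ) : 2 * π * k * θ / (2 * π) = k * θ := by
    field_simp
  have h := hasSum_mul_cos_of_even (T := 2 * π) hfcos (fun θ => congrArg f (cos_add_two_pi θ))
    (fun θ => congrArg f (cos_neg θ)) hsum
    (fun k => by
      have hk := hcoeff k
      rw [integral_measureT_eq_integral_cos] at hk
      simp only [T_real_cos, Int.cast_natCast] at hk
      simp only [hangle, mul_div_cancel_left₀ π two_ne_zero]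
      rw [hk]
      ring)
    (arccos x)
  simpa only [hangle, cos_arccos hx.1 hx.2, ← Int.cast_natCast (R := ℝ), ← T_real_cos] using h

theorem two_div_mul_sub_one_mem_Icc {lam x : ℝ} (hlam : 0 < lam) (hx : x ∈ Set.Icc 0 lam) :
    2 / lam * x - 1 ∈ Set.Icc (-1 : ℝ) 1 := by
  have h₀ : 0 ≤ x / lam := div_nonneg hx.1 hlam.le
  have h₁ : x / lam ≤ 1 := (div_le_one hlam).2 hx.2
  constructor <;> linarith [div_mul_eq_mul_div 2 lam x, mul_div_assoc 2 x lam]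

theorem hasSum_chebCoeff_mul_T {α lam x : ℝ} (hα : 0 < α) (hlam : 0 < lam)
    (hx : x ∈ Set.Icc 0 lam) :
    HasSum (fun k : ℕ => chebCoeff α lam k * (T ℝ k).eval (2 / lam * x - 1))
      (x ^ α + chebCoeff α lam 0 / 2) := by
  have hf : ContinuousOn (fun y : ℝ => ((1 + y) / 2) ^ α) (Set.Icc (-1) 1) :=
    ((by fun_prop : Continuous fun y : ℝ => (1 + y) / 2).rpow_const
      fun _ => Or.inr hα.le).continuousOn
  have hy := two_div_mul_sub_one_mem_Icc hlam hx
  have hx' : lam ^ α * ((1 + (2 / lam * x - 1)) / 2) ^ α = x ^ α := by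
    rw [← mul_rpow hlam.le (by linarith [hy.1])]
    congr 1
    field_simp
    ring
  have h := (hasSum_mul_T_of_integral_measureT hf (summable_abs_chebCoeff hα 1).of_abs
    (integral_half_one_add_rpow_mul_T_measureT hα.le) hy).mul_left (lam ^ α)
  rw [mul_add, hx', mul_div_assoc', ← chebCoeff_eq_rpow_mul] at h
  simpa only [← mul_assoc, ← chebCoeff_eq_rpow_mul] using h

/-- The truncated Chebyshev series `c 0 / 2 + ∑ k ∈ [1, m], c k * T_k (2 x / lam - 1)` on
`[0, lam]`, as a polynomial. -/
noncomputable def chebPoly (c : ℕ → ℝ) (lam : ℝ) (m : ℕ) : ℝ[X] :=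
  C (c 0 / 2) + ∑ k ∈ Finset.Icc 1 m, C (c k) * (T ℝ k).comp (C (2 / lam) * X - 1)

theorem eval_chebPoly (c : ℕ → ℝ) (lam : ℝ) (m : ℕ) (x : ℝ) :
    (chebPoly c lam m).eval x =
      ∑ k ∈ Finset.range (m + 1), c k * (T ℝ k).eval (2 / lam * x - 1) - c 0 / 2 := by
  rw [Finset.range_eq_Ico, Finset.sum_eq_sum_Ico_succ_bot m.succ_pos, zero_add,
    Nat.succ_eq_add_one, Finset.Ico_add_one_right_eq_Icc, chebPoly]
  simp only [eval_add, eval_finsetSum, eval_mul, eval_C, eval_comp, eval_sub, eval_X, eval_one,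
    Nat.cast_zero, T_zero]
  ring

theorem abs_rpow_sub_eval_chebPoly_le_tsum {α lam x : ℝ} (hα : 0 < α) (hlam : 0 < lam)
    (hx : x ∈ Set.Icc 0 lam) (m : ℕ) :
    |x ^ α - (chebPoly (chebCoeff α lam) lam m).eval x| ≤
      ∑' i, |chebCoeff α lam (i + (m + 1))| := by
  have htail := (hasSum_nat_add_iff' (m + 1)).2 (hasSum_chebCoeff_mul_T hα hlam hx)
  rw [add_sub_assoc, ← neg_sub _ (chebCoeff α lam 0 / 2), ← eval_chebPoly,
    ← sub_eq_add_neg] at htail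
  rw [← norm_eq_abs, ← htail.tsum_eq]
  refine tsum_of_norm_bounded
    ((summable_nat_add_iff (m + 1)).2 (summable_abs_chebCoeff hα lam)).hasSum fun i => ?_
  rw [norm_eq_abs, abs_mul]
  exact mul_le_of_le_one_right (abs_nonneg _) (abs_eval_T_real_le_one _
    (abs_le.2 (two_div_mul_sub_one_mem_Icc hlam hx)))

theorem abs_rpow_sub_eval_chebPoly_le {α lam x : ℝ} (hα : 0 < α) (hlam : 0 < lam)
    (hx : x ∈ Set.Icc 0 lam) {m : ℕ} (hm : α < m) :
    |x ^ α - (chebPoly (chebCoeff α lam) lam m).eval x| ≤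
      lam ^ α * tailConst α / (m - α) ^ (2 * α) :=
  (abs_rpow_sub_eval_chebPoly_le_tsum hα hlam hx m).trans (tsum_abs_chebCoeff_le hα hlam.le hm)

end Expansion

section Concentration

open MeasureTheory ProbabilityTheory Real

theorem mgf_sq_gaussianReal {t : ℝ} (ht : 2 * t < 1) :
    mgf (fun x => x ^ 2) (gaussianReal 0 1) t = (√(1 - 2 * t))⁻¹ := by
  have hpdf (x : ℝ) : gaussianPDFReal 0 1 x • exp (t * x ^ 2) =
      (√(2 * π))⁻¹ * exp (-(1 / 2 - t) * x ^ 2) := by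
    rw [gaussianPDFReal_def, smul_eq_mul, mul_assoc, ← exp_add]
    simp only [NNReal.coe_one, mul_one, sub_zero]
    ring_nf
  rw [mgf, integral_gaussianReal_eq_integral_smul one_ne_zero]
  simp_rw [hpdf]
  rw [integral_const_mul, integral_gaussian, ← sqrt_inv, ← sqrt_inv, ← sqrt_mul (by positivity)]
  congr 1
  have : 1 / 2 - t ≠ 0 := by linarith
  rw [show 1 - 2 * t = 2 * (1 / 2 - t) by ring]
  field_simp

theorem inv_sqrt_one_sub_two_mul_le_exp {b : ℝ} (hb : |b| ≤ 1 / 6) :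
    (√(1 - 2 * b))⁻¹ ≤ exp (b + 2 * b ^ 2) := by
  have hpos : 0 < 1 - 2 * b := by linarith [le_abs_self b]
  have hx : |2 * b| ≤ 1 / 3 := by rw [abs_mul, abs_two]; linarith
  have htaylor := neg_le_of_abs_le (abs_log_sub_add_sum_range_le (x := 2 * b) (by linarith) 2)
  have hrem : |2 * b| ^ (2 + 1) / (1 - |2 * b|) ≤ 2 * b ^ 2 := by
    rw [div_le_iff₀ (by linarith), pow_succ, sq_abs]
    nlinarith [sq_nonneg b]
  norm_num [Finset.sum_range_succ] at htaylor hrem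
  rw [← log_le_iff_le_exp (by positivity), log_inv, log_sqrt hpos.le]
  linarith

theorem measureReal_card_mul_add_le_sum_le {ι Ω : Type*} [Fintype ι] [MeasurableSpace Ω]
    {P : Measure Ω} {Y : ι → Ω → ℝ} (hY : ∀ i, AEMeasurable (Y i) P) (hindep : iIndepFun Y P)
    {a v t : ℝ} (ht : 0 ≤ t) (hint : ∀ i, Integrable (fun ω => exp (t * Y i ω)) P)
    (hmgf : ∀ i, mgf (Y i) P t ≤ exp (t * a + v * t ^ 2)) (η : ℝ) :
    P.real {ω | Fintype.card ι * (a + η) ≤ ∑ i, Y i ω} ≤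
      exp (Fintype.card ι * (v * t ^ 2 - t * η)) := by
  have := hindep.isProbabilityMeasure
  have hsum := hindep.mgf_sum₀ (t := t) hY Finset.univ
  have hint_sum : Integrable (fun ω => exp (t * (∑ i, Y i) ω)) P := by
    rw [← mgf_pos_iff, hsum]
    exact Finset.prod_pos fun i _ => mgf_pos (hint i)
  have hmgf_sum : mgf (∑ i, Y i) P t ≤ exp (t * a + v * t ^ 2) ^ Fintype.card ι := by
    rw [hsum]
    exact (Finset.prod_le_prod (fun i _ => mgf_nonneg) fun i _ => hmgf i).trans_eq
      (Finset.prod_const _)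
  calc P.real {ω | Fintype.card ι * (a + η) ≤ ∑ i, Y i ω}
    _ ≤ exp (-t * (Fintype.card ι * (a + η))) * mgf (∑ i, Y i) P t := by
      simpa only [Finset.sum_apply] using measure_ge_le_exp_mul_mgf _ ht hint_sum
    _ ≤ exp (-t * (Fintype.card ι * (a + η))) * exp (t * a + v * t ^ 2) ^ Fintype.card ι := by
      gcongr
    _ = exp (Fintype.card ι * (v * t ^ 2 - t * η)) := by
      rw [← exp_nat_mul, ← exp_add]
      ring_nf

theorem measureReal_card_mul_le_abs_sum_sub_le {ι Ω : Type*} [Fintype ι] [MeasurableSpace Ω]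
    {P : Measure Ω} {Y : ι → Ω → ℝ} (hY : ∀ i, AEMeasurable (Y i) P) (hindep : iIndepFun Y P)
    {a v r η : ℝ} (hv : 0 < v) (hη0 : 0 ≤ η) (hη : η ≤ 2 * v * r)
    (hint : ∀ i t, |t| ≤ r → Integrable (fun ω => exp (t * Y i ω)) P)
    (hmgf : ∀ i t, |t| ≤ r → mgf (Y i) P t ≤ exp (t * a + v * t ^ 2)) :
    P.real {ω | Fintype.card ι * η ≤ |∑ i, Y i ω - Fintype.card ι * a|} ≤
      2 * exp (-(Fintype.card ι * η ^ 2 / (4 * v))) := by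
  have := hindep.isProbabilityMeasure
  -- the minimiser of `v * t ^ 2 - t * η`
  set t := η / (2 * v) with ht
  have ht0 : 0 ≤ t := by positivity
  have htr : |t| ≤ r := by
    rw [abs_of_nonneg ht0, div_le_iff₀ (by positivity)]
    linarith
  have htr' : |-t| ≤ r := by rwa [abs_neg]
  have hexp : Fintype.card ι * (v * t ^ 2 - t * η) = -(Fintype.card ι * η ^ 2 / (4 * v)) := by
    rw [ht]
    field_simp
    ring
  have hupper := measureReal_card_mul_add_le_sum_le hY hindep ht0 (fun i => hint i t htr)
    (fun i => hmgf i t htr) η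
  have hlower := measureReal_card_mul_add_le_sum_le (a := -a) (v := v) (fun i => (hY i).neg)
    (hindep.comp (fun _ => Neg.neg) fun _ => measurable_neg) ht0
    (fun i => by simpa using hint i (-t) htr')
    (fun i => by simpa [mgf_neg, Function.comp_def, ← Pi.neg_def] using hmgf i (-t) htr') η
  rw [hexp] at hupper hlower
  calc P.real {ω | Fintype.card ι * η ≤ |∑ i, Y i ω - Fintype.card ι * a|}
    _ ≤ P.real ({ω | Fintype.card ι * (a + η) ≤ ∑ i, Y i ω} ∪
          {ω | Fintype.card ι * (-a + η) ≤ ∑ i, (Neg.neg ∘ Y i) ω}) := by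
      refine measureReal_mono fun ω hω => ?_
      simp only [Set.mem_union, Set.mem_ofPred_eq, Function.comp_apply,
        Finset.sum_neg_distrib] at hω ⊢
      rcases le_abs'.1 hω with h | h
      · exact .inr (by linarith)
      · exact .inl (by linarith)
    _ ≤ _ := (measureReal_union_le _ _).trans (add_le_add hupper hlower)
    _ = _ := (two_mul _).symm

section GaussianQuadraticForm

variable {ι E : Type*} [Fintype ι] [NormedAddCommGroup E] [InnerProductSpace ℝ E]

/-- The quadratic form that is diagonal in the orthonormal basis `b`, with diagonal entries `μ`.
At a standard Gaussian vector it is Hutchinson's estimator of the trace `∑ i, μ i`. -/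
noncomputable def diagForm (b : OrthonormalBasis ι ℝ E) (μ : ι → ℝ) (v : E) : ℝ :=
  ∑ i, μ i * b.repr v i ^ 2

theorem continuous_diagForm (b : OrthonormalBasis ι ℝ E) (μ : ι → ℝ) :
    Continuous (diagForm b μ) := by
  unfold diagForm
  fun_prop

variable [FiniteDimensional ℝ E] [MeasurableSpace E] [BorelSpace E]

theorem mgf_diagForm_stdGaussian (b : OrthonormalBasis ι ℝ E) (μ : ι → ℝ) {t : ℝ}
    (ht : ∀ i, 2 * (t * μ i) < 1) :
    mgf (diagForm b μ) (stdGaussian E) t = ∏ i, (√(1 - 2 * (t * μ i)))⁻¹ := by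
  have hcoord (z : ι → ℝ) :
      exp (t * diagForm b μ (∑ i, z i • b i)) = ∏ i, exp (t * μ i * z i ^ 2) := by
    simp only [diagForm, b.repr_apply_apply, b.orthonormal.inner_right_fintype, Finset.mul_sum,
      exp_sum, mul_assoc]
  have hmeas := (continuous_exp.comp (continuous_const_mul t |>.comp (continuous_diagForm b μ)))
  rw [stdGaussian_eq_map_pi_orthonormalBasis b,
    mgf_map (Measurable.aemeasurable (by fun_prop)) hmeas.aestronglyMeasurable, mgf]
  simp only [Function.comp_apply, hcoord]
  rw [integral_fintype_prod_eq_prod fun i x => exp (t * μ i * x ^ 2)]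
  exact Finset.prod_congr rfl fun i _ => mgf_sq_gaussianReal (ht i)

theorem abs_mul_le_of_sum_abs_le {μ : ι → ℝ} {M t c : ℝ} (hμ : ∑ i, |μ i| ≤ M)
    (ht : |t| * M ≤ c) (i : ι) : |t * μ i| ≤ c := by
  rw [abs_mul]
  exact (mul_le_mul_of_nonneg_left
    ((Finset.single_le_sum (fun j _ => abs_nonneg (μ j)) (Finset.mem_univ i)).trans hμ)
    (abs_nonneg t)).trans ht

theorem mgf_diagForm_stdGaussian_pos (b : OrthonormalBasis ι ℝ E) {μ : ι → ℝ} {M t : ℝ}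
    (hμ : ∑ i, |μ i| ≤ M) (ht : |t| * M ≤ 1 / 6) : 0 < mgf (diagForm b μ) (stdGaussian E) t := by
  have hlt (i : ι) : 2 * (t * μ i) < 1 := by
    linarith [(abs_le.1 (abs_mul_le_of_sum_abs_le hμ ht i)).2]
  rw [mgf_diagForm_stdGaussian b μ hlt]
  exact Finset.prod_pos fun i _ => inv_pos.2 (sqrt_pos.2 (sub_pos.2 (hlt i)))

theorem mgf_diagForm_stdGaussian_le (b : OrthonormalBasis ι ℝ E) {μ : ι → ℝ} {M t : ℝ}
    (hμ : ∑ i, |μ i| ≤ M) (ht : |t| * M ≤ 1 / 6) :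
    mgf (diagForm b μ) (stdGaussian E) t ≤ exp (t * ∑ i, μ i + 2 * M ^ 2 * t ^ 2) := by
  have hle := abs_mul_le_of_sum_abs_le hμ ht
  have hsq : ∑ i, (t * μ i) ^ 2 ≤ (t * M) ^ 2 := calc
    ∑ i, (t * μ i) ^ 2 = ∑ i, |t * μ i| ^ 2 := by simp only [sq_abs]
    _ ≤ (∑ i, |t * μ i|) ^ 2 := Finset.sum_sq_le_sq_sum_of_nonneg fun _ _ => abs_nonneg _
    _ = (t * ∑ i, |μ i|) ^ 2 := by simp only [abs_mul, ← Finset.mul_sum, mul_pow, sq_abs]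
    _ ≤ (t * M) ^ 2 := by
      rw [mul_pow, mul_pow]
      gcongr
  calc mgf (diagForm b μ) (stdGaussian E) t
    _ = ∏ i, (√(1 - 2 * (t * μ i)))⁻¹ :=
      mgf_diagForm_stdGaussian b μ fun i => by linarith [(abs_le.1 (hle i)).2]
    _ ≤ ∏ i, exp (t * μ i + 2 * (t * μ i) ^ 2) :=
      Finset.prod_le_prod (fun i _ => by positivity)
        fun i _ => inv_sqrt_one_sub_two_mul_le_exp (hle i)
    _ = exp (t * ∑ i, μ i + 2 * ∑ i, (t * μ i) ^ 2) := by
      rw [← exp_sum, Finset.sum_add_distrib, Finset.mul_sum, Finset.mul_sum]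
    _ ≤ exp (t * ∑ i, μ i + 2 * M ^ 2 * t ^ 2) := by
      rw [exp_le_exp]
      linarith

theorem measureReal_card_mul_le_abs_sum_diagForm_sub_le {κ Ω : Type*} [Fintype κ]
    [MeasurableSpace Ω] {P : Measure Ω} {g : κ → Ω → E}
    (hg : ∀ j, HasLaw (g j) (stdGaussian E) P) (hindep : iIndepFun g P)
    (b : OrthonormalBasis ι ℝ E) {μ : ι → ℝ} {M ε : ℝ} (hM : 0 < M) (hμ : ∑ i, |μ i| ≤ M)
    (hε0 : 0 ≤ ε) (hε1 : 3 * ε ≤ 2) :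
    P.real {ω | Fintype.card κ * (ε * M) ≤
        |∑ j, diagForm b μ (g j ω) - Fintype.card κ * ∑ i, μ i|} ≤
      2 * exp (-(Fintype.card κ * ε ^ 2 / 8)) := by
  have := hindep.isProbabilityMeasure
  have hmeas := (continuous_diagForm b μ).measurable
  have hmgf (j : κ) (t : ℝ) :
      mgf (fun ω => diagForm b μ (g j ω)) P t = mgf (diagForm b μ) (stdGaussian E) t := by
    rw [← (hg j).map_eq, mgf_map (hg j).aemeasurable
      (hmeas.const_mul t).exp.aestronglyMeasurable, Function.comp_def]
  have hr {t : ℝ} (ht : |t| ≤ 1 / (6 * M)) : |t| * M ≤ 1 / 6 := by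
    rw [le_div_iff₀ (by positivity)] at ht
    linarith
  refine (measureReal_card_mul_le_abs_sum_sub_le (v := 2 * M ^ 2) (r := 1 / (6 * M))
    (fun j => hmeas.comp_aemeasurable (hg j).aemeasurable)
    (hindep.comp (fun _ => diagForm b μ) fun _ => hmeas) (by positivity) (by positivity) ?_
    (fun j t ht => ?_) fun j t ht => ?_).trans_eq ?_
  · field_simp
    linarith
  · exact mgf_pos_iff.1 ((mgf_diagForm_stdGaussian_pos b hμ (hr ht)).trans_eq (hmgf j t).symm)
  · exact (hmgf j t).trans_le (mgf_diagForm_stdGaussian_le b hμ (hr ht))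
  · field_simp
    norm_num

end GaussianQuadraticForm

end Concentration

section QuadraticForm

open Polynomial

section Spectral

variable {ι : Type*} [Fintype ι] [DecidableEq ι] {G : Matrix ι ι ℝ}

theorem aeval_mulVec_eigenvectorBasis (hG : G.IsHermitian) (p : ℝ[X]) (i : ι) :
    aeval G p *ᵥ (hG.eigenvectorBasis i).ofLp =
      p.eval (hG.eigenvalues i) • (hG.eigenvectorBasis i).ofLp := by
  have h := Module.End.aeval_apply_of_mem_apply_eq_smul (f := Matrix.toLinAlgEquiv' G) (p := p)
    (hG.mulVec_eigenvectorBasis i)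
  rwa [aeval_algHom_apply] at h

theorem dotProduct_aeval_mulVec (hG : G.IsHermitian) (p : ℝ[X]) (v : EuclideanSpace ℝ ι) :
    v.ofLp ⬝ᵥ (aeval G p *ᵥ v.ofLp) =
      diagForm hG.eigenvectorBasis (fun i => p.eval (hG.eigenvalues i)) v := by
  set b := hG.eigenvectorBasis with hb
  have hpv : WithLp.toLp 2 (aeval G p *ᵥ v.ofLp) =
      ∑ i, (p.eval (hG.eigenvalues i) * b.repr v i) • b i := by
    conv_lhs => rw [← b.sum_repr v]
    simp only [WithLp.ofLp_sum, WithLp.ofLp_smul, Matrix.mulVec_sum, Matrix.mulVec_smul, hb,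
      aeval_mulVec_eigenvectorBasis, smul_smul, mul_comm, WithLp.toLp_sum, WithLp.toLp_smul]
  calc v.ofLp ⬝ᵥ (aeval G p *ᵥ v.ofLp)
    _ = inner ℝ v (WithLp.toLp 2 (aeval G p *ᵥ v.ofLp)) := by
      rw [EuclideanSpace.inner_eq_star_dotProduct, star_trivial, dotProduct_comm]
    _ = _ := by
      rw [hpv, inner_sum, diagForm]
      refine Finset.sum_congr rfl fun i _ => ?_
      rw [inner_smul_right, real_inner_comm, ← b.repr_apply_apply]
      ring

end Spectral

variable {n : ℕ}

theorem chebSum_eq_aeval (c : ℕ → ℝ) (lam : ℝ) (G : Matrix (Fin n) (Fin n) ℝ) (m : ℕ) :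
    chebSum c lam G m = aeval G (chebPoly c lam m) := by
  simp only [chebSum, chebPoly, map_add, map_sum, map_mul, aeval_C, aeval_comp, map_sub, aeval_X,
    map_one, Algebra.algebraMap_eq_smul_one, smul_mul_assoc, one_mul]

theorem clenshawForm_eq_diagForm {G : Matrix (Fin n) (Fin n) ℝ} (hG : G.IsHermitian) (c : ℕ → ℝ)
    (lam : ℝ) (m : ℕ) (v : EuclideanSpace ℝ (Fin n)) :
    clenshawForm c lam G m v.ofLp =
      diagForm hG.eigenvectorBasis (fun i => (chebPoly c lam m).eval (hG.eigenvalues i)) v := by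
  rw [clenshawForm_eq, chebSum_eq_aeval, dotProduct_aeval_mulVec hG]

section KernelMatrix

variable {X : Type*} {φ : X → X → ℝ} {x : Fin n → X}

theorem IsPositiveKernel.posSemidef_normalizedKernelMatrix (hφ : IsPositiveKernel φ)
    (hx : ∀ i, 0 ≤ φ (x i) (x i)) : (normalizedKernelMatrix φ x).PosSemidef := by
  convert (hφ n x).conjTranspose_mul_mul_same
    (Matrix.diagonal fun i => 1 / (√n * √(φ (x i) (x i)))) using 1
  ext i j
  rw [Matrix.diagonal_conjTranspose, Matrix.mul_diagonal, Matrix.diagonal_mul]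
  simp only [normalizedKernelMatrix, Matrix.of_apply, star_trivial]
  rw [Real.sqrt_mul (hx i), ← Real.mul_self_sqrt n.cast_nonneg, Real.sqrt_mul_self (by positivity)]
  ring

theorem trace_normalizedKernelMatrix (hn : n ≠ 0) (hx : ∀ i, 0 < φ (x i) (x i)) :
    (normalizedKernelMatrix φ x).trace = 1 := by
  have hdiag (i : Fin n) : normalizedKernelMatrix φ x i i = 1 / n := by
    simp only [normalizedKernelMatrix, Matrix.of_apply]
    rw [Real.sqrt_mul_self (hx i).le, div_self (hx i).ne', mul_one]
  simp [Matrix.trace, hdiag, hn]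

theorem normalizedKernelMatrix_ne_zero (hn : n ≠ 0) (hx : ∀ i, 0 < φ (x i) (x i)) :
    normalizedKernelMatrix φ x ≠ 0 := fun h => by
  simpa [h] using trace_normalizedKernelMatrix hn hx

end KernelMatrix

end QuadraticForm

section Degree

open Real

variable {n : ℕ} {G : Matrix (Fin n) (Fin n) ℝ}

theorem eigenvalues_le_lambdaMax (hG : G.IsHermitian) (i : Fin n) :
    hG.eigenvalues i ≤ lambdaMax hG :=
  le_ciSup (Set.finite_range _).bddAbove i

theorem lambdaMin_le_eigenvalues (hG : G.IsHermitian) (i : Fin n) :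
    lambdaMin hG ≤ hG.eigenvalues i :=
  ciInf_le (Set.finite_range _).bddBelow i

theorem lambdaMax_pos (hG : G.PosSemidef) (hG0 : G ≠ 0) : 0 < lambdaMax hG.isHermitian := by
  obtain ⟨i, hi⟩ := Function.ne_iff.1 (mt hG.isHermitian.eigenvalues_eq_zero_iff.1 hG0)
  exact ((hG.eigenvalues_nonneg i).lt_of_ne' hi).trans_le (eigenvalues_le_lambdaMax _ i)

theorem lambdaMax_rpow_le_sum [NeZero n] (hG : G.PosSemidef) (α : ℝ) :
    lambdaMax hG.isHermitian ^ α ≤ ∑ i, hG.isHermitian.eigenvalues i ^ α := by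
  obtain ⟨i, hi⟩ := exists_eq_ciSup_of_finite (f := hG.isHermitian.eigenvalues)
  rw [lambdaMax, ← hi]
  exact Finset.single_le_sum (f := fun i => hG.isHermitian.eigenvalues i ^ α)
    (fun j _ => rpow_nonneg (hG.eigenvalues_nonneg j) α) (Finset.mem_univ i)

theorem card_mul_lambdaMin_rpow_le_sum (hG : G.IsHermitian) (hmin : 0 ≤ lambdaMin hG) {α : ℝ}
    (hα : 0 ≤ α) : n * lambdaMin hG ^ α ≤ ∑ i, hG.eigenvalues i ^ α := by
  simpa using Finset.card_nsmul_le_sum Finset.univ _ _ fun i _ =>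
    rpow_le_rpow hmin (lambdaMin_le_eigenvalues hG i) hα

theorem neZero_of_ne_zero (hG0 : G ≠ 0) : NeZero n :=
  ⟨by rintro rfl; exact hG0 (Subsingleton.elim _ _)⟩

theorem sum_eigenvalues_rpow_pos (hG : G.PosSemidef) (hG0 : G ≠ 0) (α : ℝ) :
    0 < ∑ i, hG.isHermitian.eigenvalues i ^ α :=
  have := neZero_of_ne_zero hG0
  (rpow_pos_of_pos (lambdaMax_pos hG hG0) α).trans_le (lambdaMax_rpow_le_sum hG α)

/-- The bound on `(m - α) ^ (2 * α)` that makes the total error of the degree `m` Chebyshev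
approximation at most `ε * ∑ i, λ_i ^ α`. It is what `chebDegree` solves for `m`. -/
noncomputable def degreeGap (hG : G.IsHermitian) (α ε : ℝ) : ℝ :=
  (if 0 < lambdaMin hG then condNumber hG ^ α else n) * (tailConst α / ε)

variable {α ε : ℝ}

theorem degreeGap_pos (hG : G.PosSemidef) (hG0 : G ≠ 0) (hα : 0 < α) (hε : 0 < ε) :
    0 < degreeGap hG.isHermitian α ε := by
  have := neZero_of_ne_zero hG0
  refine mul_pos ?_ (div_pos (tailConst_pos hα) hε)
  split_ifs with hmin
  · exact rpow_pos_of_pos (div_pos (lambdaMax_pos hG hG0) hmin) α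
  · exact Nat.cast_pos.2 (NeZero.pos n)

theorem chebDegree_eq (hG : G.PosSemidef) (hG0 : G ≠ 0) (hα : 0 < α) (hε : 0 < ε) :
    chebDegree hG.isHermitian α ε = ⌈α + degreeGap hG.isHermitian α ε ^ (2 * α)⁻¹⌉₊ := by
  have htail := div_pos (tailConst_pos hα) hε
  rw [chebDegree, degreeGap, ite_mul, apply_ite (· ^ (2 * α)⁻¹)]
  congr 2
  refine if_ctx_congr Iff.rfl (fun hmin => ?_) fun _ => ?_
  · have hκ : 0 ≤ condNumber hG.isHermitian := div_nonneg (lambdaMax_pos hG hG0).le hmin.le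
    have hexp : α * (2 * α)⁻¹ = 1 / 2 := by field_simp
    rw [mul_rpow (rpow_nonneg hκ α) htail.le, ← rpow_mul hκ, hexp, sqrt_eq_rpow, tailConst,
      div_div, mul_comm ε, one_div (2 * α)]
  · rw [tailConst, div_div, mul_comm ε, one_div (2 * α), mul_div_assoc', mul_assoc]

theorem degreeGap_rpow_le_sub (hG : G.PosSemidef) (hG0 : G ≠ 0) (hα : 0 < α) (hε : 0 < ε) {m : ℕ}
    (hm : chebDegree hG.isHermitian α ε ≤ m) :
    degreeGap hG.isHermitian α ε ^ (2 * α)⁻¹ ≤ m - α := by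
  rw [chebDegree_eq hG hG0 hα hε] at hm
  exact le_sub_iff_add_le'.2 (Nat.ceil_le.1 hm)

theorem lt_of_chebDegree_le (hG : G.PosSemidef) (hG0 : G ≠ 0) (hα : 0 < α) (hε : 0 < ε) {m : ℕ}
    (hm : chebDegree hG.isHermitian α ε ≤ m) : α < m :=
  sub_pos.1 ((rpow_pos_of_pos (degreeGap_pos hG hG0 hα hε) _).trans_le
    (degreeGap_rpow_le_sub hG hG0 hα hε hm))

theorem card_mul_lambdaMax_rpow_mul_tailConst_le (hG : G.PosSemidef) (hG0 : G ≠ 0) (hα : 0 < α)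
    (hε : 0 < ε) :
    n * (lambdaMax hG.isHermitian ^ α * tailConst α) ≤
      ε * (∑ i, hG.isHermitian.eigenvalues i ^ α) * degreeGap hG.isHermitian α ε := by
  have := neZero_of_ne_zero hG0
  have hmax := lambdaMax_pos hG hG0
  have htail := tailConst_pos hα
  rw [degreeGap]
  split_ifs with hmin
  · have hsum := card_mul_lambdaMin_rpow_le_sum hG.isHermitian hmin.le hα.le
    have := rpow_pos_of_pos hmin α
    rw [condNumber, div_rpow hmax.le hmin.le]
    calc n * (lambdaMax hG.isHermitian ^ α * tailConst α)
      _ = ε * (n * lambdaMin hG.isHermitian ^ α) * (lambdaMax hG.isHermitian ^ α /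
            lambdaMin hG.isHermitian ^ α * (tailConst α / ε)) := by field_simp
      _ ≤ _ := by gcongr
  · calc n * (lambdaMax hG.isHermitian ^ α * tailConst α)
      _ = ε * lambdaMax hG.isHermitian ^ α * (n * (tailConst α / ε)) := by field_simp
      _ ≤ _ := by gcongr; exact lambdaMax_rpow_le_sum hG α

/-- The eigenvalues `f_m(λ_i)` of `f_m(G)`, where `f_m` is the degree `m` Chebyshev approximation
of `x ^ α` on `[0, λ_max]`. -/
noncomputable def chebEigenvalues (hG : G.IsHermitian) (α : ℝ) (m : ℕ) (i : Fin n) : ℝ :=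
  (chebPoly (chebCoeff α (lambdaMax hG)) (lambdaMax hG) m).eval (hG.eigenvalues i)

theorem sum_abs_rpow_sub_chebEigenvalues_le (hG : G.PosSemidef) (hG0 : G ≠ 0) (hα : 0 < α)
    (hε : 0 < ε) {m : ℕ} (hm : chebDegree hG.isHermitian α ε ≤ m) :
    ∑ i, |hG.isHermitian.eigenvalues i ^ α - chebEigenvalues hG.isHermitian α m i| ≤
      ε * ∑ i, hG.isHermitian.eigenvalues i ^ α := by
  set lam := lambdaMax hG.isHermitian
  have hlt := lt_of_chebDegree_le hG hG0 hα hε hm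
  have hgap : degreeGap hG.isHermitian α ε ≤ (m - α) ^ (2 * α) :=
    (rpow_inv_le_iff_of_pos (degreeGap_pos hG hG0 hα hε).le (sub_pos.2 hlt).le
      (by positivity)).1 (degreeGap_rpow_le_sub hG hG0 hα hε hm)
  calc _ ≤ ∑ _ : Fin n, lam ^ α * tailConst α / (m - α) ^ (2 * α) :=
      Finset.sum_le_sum fun i _ => abs_rpow_sub_eval_chebPoly_le hα (lambdaMax_pos hG hG0)
        ⟨hG.eigenvalues_nonneg i, eigenvalues_le_lambdaMax _ i⟩ hlt
    _ = n * (lam ^ α * tailConst α) / (m - α) ^ (2 * α) := by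
      rw [Finset.sum_const, Finset.card_univ, Fintype.card_fin, nsmul_eq_mul, mul_div_assoc']
    _ ≤ _ := by
      rw [div_le_iff₀ (rpow_pos_of_pos (sub_pos.2 hlt) _)]
      refine (card_mul_lambdaMax_rpow_mul_tailConst_le hG hG0 hα hε).trans ?_
      gcongr
      exact mul_nonneg hε.le (sum_eigenvalues_rpow_pos hG hG0 α).le

end Degree

section Estimator

open MeasureTheory ProbabilityTheory

theorem sum_abs_le_of_sum_abs_sub_le {ι : Type*} [Fintype ι] {a b : ι → ℝ} {ε : ℝ}
    (hb : ∀ i, 0 ≤ b i) (h : ∑ i, |b i - a i| ≤ ε * ∑ i, b i) :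
    ∑ i, |a i| ≤ (1 + ε) * ∑ i, b i := by
  have hle (i : ι) : |a i| ≤ b i + |b i - a i| := by
    have := abs_sub_abs_le_abs_sub (a i) (b i)
    rw [abs_of_nonneg (hb i), abs_sub_comm] at this
    linarith
  refine (Finset.sum_le_sum fun i _ => hle i).trans ?_
  rw [Finset.sum_add_distrib]
  linarith

theorem abs_logb_sub_logb_le {b A T η : ℝ} (hb : 1 < b) (hT : 0 < T) (hη0 : 0 ≤ η) (hη1 : η < 1)
    (h : |A - T| ≤ η * T) :
    0 < A ∧ |Real.logb b T - Real.logb b A| ≤ |Real.logb b (1 - η)| := by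
  obtain ⟨hl, hu⟩ := abs_le.1 h
  have h1 : 0 < 1 - η := sub_pos.2 hη1
  have hlower : (1 - η) * T ≤ A := by linarith
  have hA : 0 < A := (mul_pos h1 hT).trans_le hlower
  -- `(1 - η) * (1 + η) ≤ 1`
  have hupper : (1 - η) * A ≤ T := by nlinarith [mul_nonneg (sq_nonneg η) hT.le]
  have hlog_lower := Real.logb_le_logb_of_le hb (mul_pos h1 hT) hlower
  have hlog_upper := Real.logb_le_logb_of_le hb (mul_pos h1 hA) hupper
  rw [Real.logb_mul h1.ne' hT.ne'] at hlog_lower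
  rw [Real.logb_mul h1.ne' hA.ne'] at hlog_upper
  refine ⟨hA, ?_⟩
  rw [abs_of_nonpos (Real.logb_nonpos hb h1.le (by linarith)), abs_le]
  constructor <;> linarith

theorem two_mul_exp_le_of_numVectors_le {ε δ : ℝ} (hε : 0 < ε) (hδ : 0 < δ) {s : ℕ}
    (hs : numVectors ε δ ≤ s) : 2 * Real.exp (-(s * ε ^ 2 / 8)) ≤ δ := by
  have hlog := Nat.ceil_le.1 hs
  rw [div_le_iff₀ (by positivity)] at hlog
  calc 2 * Real.exp (-(s * ε ^ 2 / 8))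
    _ ≤ 2 * Real.exp (-Real.log (2 / δ)) := by
      gcongr
      linarith
    _ = δ := by
      rw [Real.exp_neg, Real.exp_log (by positivity)]
      field_simp

variable {n s m : ℕ} {G : Matrix (Fin n) (Fin n) ℝ} {α ε : ℝ}

theorem natCast_mul_traceEstimate (hG : G.IsHermitian) (g : Fin s → EuclideanSpace ℝ (Fin n)) :
    s * traceEstimate hG α s m g =
      ∑ j, diagForm hG.eigenvectorBasis (chebEigenvalues hG α m) (g j) := by
  simp only [traceEstimate, clenshawForm_eq_diagForm hG]
  rcases eq_or_ne s 0 with rfl | hs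
  · simp
  · rw [← mul_assoc, mul_one_div_cancel (Nat.cast_ne_zero.2 hs), one_mul]
    rfl

theorem abs_entropy_sub_entropyEstimate_le (hG : G.PosSemidef) (hG0 : G ≠ 0) (hε0 : 0 ≤ ε)
    (hε1 : 3 * ε < 1) (g : Fin s → EuclideanSpace ℝ (Fin n))
    (h : |traceEstimate hG.isHermitian α s m g - ∑ i, hG.isHermitian.eigenvalues i ^ α| ≤
      3 * ε * ∑ i, hG.isHermitian.eigenvalues i ^ α) :
    0 < traceEstimate hG.isHermitian α s m g ∧
      |entropy hG.isHermitian α - entropyEstimate hG.isHermitian α s m g| ≤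
        |1 / (1 - α) * Real.logb 2 (1 - 3 * ε)| := by
  refine (abs_logb_sub_logb_le one_lt_two (sum_eigenvalues_rpow_pos hG hG0 α) (by positivity) hε1
    h).imp_right fun hlog => ?_
  rw [entropy, entropyEstimate, ← mul_sub, abs_mul, abs_mul]
  gcongr

theorem measureReal_lt_abs_traceEstimate_sub_le (hG : G.PosSemidef) (hG0 : G ≠ 0) (hα : 0 < α)
    (hε0 : 0 < ε) (hε1 : 3 * ε ≤ 2) (hm : chebDegree hG.isHermitian α ε ≤ m)
    {Ω : Type*} [MeasurableSpace Ω] {P : Measure Ω} {g : Fin s → Ω → EuclideanSpace ℝ (Fin n)}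
    (hlaw : ∀ j, HasLaw (g j) (stdGaussian (EuclideanSpace ℝ (Fin n))) P)
    (hindep : iIndepFun g P) :
    P.real {ω | 3 * ε * ∑ i, hG.isHermitian.eigenvalues i ^ α <
        |traceEstimate hG.isHermitian α s m (fun j => g j ω) -
          ∑ i, hG.isHermitian.eigenvalues i ^ α|} ≤ 2 * Real.exp (-(s * ε ^ 2 / 8)) := by
  have := hindep.isProbabilityMeasure
  set T := ∑ i, hG.isHermitian.eigenvalues i ^ α with hT
  set μ := chebEigenvalues hG.isHermitian α m
  have hTpos : 0 < T := sum_eigenvalues_rpow_pos hG hG0 α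
  have herr := sum_abs_rpow_sub_chebEigenvalues_le hG hG0 hα hε0 hm
  have hbias : |∑ i, μ i - T| ≤ ε * T := by
    rw [abs_sub_comm, hT, ← Finset.sum_sub_distrib]
    exact (Finset.abs_sum_le_sum_abs _ _).trans herr
  have hconc := measureReal_card_mul_le_abs_sum_diagForm_sub_le hlaw hindep
    hG.isHermitian.eigenvectorBasis (mul_pos (by positivity) hTpos)
    (sum_abs_le_of_sum_abs_sub_le (fun i => Real.rpow_nonneg (hG.eigenvalues_nonneg i) α) herr)
    hε0.le hε1
  rw [Fintype.card_fin] at hconc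
  refine (measureReal_mono fun ω hω => ?_).trans hconc
  rw [Set.mem_ofPred_eq] at hω ⊢
  rw [← natCast_mul_traceEstimate, ← mul_sub, abs_mul, Nat.abs_cast]
  gcongr
  have htri := abs_sub_le (traceEstimate hG.isHermitian α s m fun j => g j ω) (∑ i, μ i) T
  have hεT : 0 ≤ ε * T * (1 - ε) := mul_nonneg (by positivity) (by linarith)
  linarith

end Estimator

end RenyiChebyshev

open RenyiChebyshev MeasureTheory ProbabilityTheory

theorem theorem3_general {n : ℕ} {G : Matrix (Fin n) (Fin n) ℝ} (hG : G.PosSemidef) (hG0 : G ≠ 0)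
    {α ε δ : ℝ} (hα0 : 0 < α) (hα1 : α ≠ 1) (hε0 : 0 < ε) (hε1 : 3 * ε < 1) (hδ : 0 < δ)
    {s m : ℕ} (hs : numVectors ε δ ≤ s) (hm : chebDegree hG.isHermitian α ε ≤ m)
    {Ω : Type*} [MeasurableSpace Ω] {P : Measure Ω}
    {g : Fin s → Ω → EuclideanSpace ℝ (Fin n)}
    (hlaw : ∀ j, HasLaw (g j) (stdGaussian (EuclideanSpace ℝ (Fin n))) P)
    (hindep : iIndepFun g P) :
    1 - δ ≤ P.real {ω |
      0 < traceEstimate hG.isHermitian α s m (fun j => g j ω) ∧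
      |entropy hG.isHermitian α - entropyEstimate hG.isHermitian α s m (fun j => g j ω)| ≤
        |1 / (1 - α) * Real.logb 2 (1 - 3 * ε)|} := by
  have := hindep.isProbabilityMeasure
  set T := ∑ i, hG.isHermitian.eigenvalues i ^ α
  set bad : Set Ω :=
    {ω | 3 * ε * T < |traceEstimate hG.isHermitian α s m (fun j => g j ω) - T|}
  have hbad : P.real bad ≤ δ :=
    (measureReal_lt_abs_traceEstimate_sub_le hG hG0 hα0 hε0 (by linarith) hm hlaw hindep).trans
      (two_mul_exp_le_of_numVectors_le hε0 hδ hs)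
  have hcover : 1 ≤ P.real bad + P.real badᶜ := by
    simpa using measureReal_union_le (μ := P) bad badᶜ
  calc 1 - δ ≤ P.real badᶜ := by linarith
    _ ≤ _ := measureReal_mono fun ω hω =>
      abs_entropy_sub_entropyEstimate_le hG hG0 hε0.le hε1 _ (not_lt.1 hω)

theorem theorem3 {X : Type*} {n : ℕ} (hn : 0 < n)
    (φ : X → X → ℝ) (hφ : RenyiChebyshev.IsPositiveKernel φ)
    (x : Fin n → X) (hx : ∀ i, 0 < φ (x i) (x i))
    (α ε δ : ℝ) (hα0 : 0 < α) (hα1 : α ≠ 1) (hε0 : 0 < ε) (hε1 : 3 * ε < 1)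
    (hδ0 : 0 < δ) (hδ1 : δ < 1)
    (s m : ℕ) (hs : s = RenyiChebyshev.numVectors ε δ)
    (hm : m = RenyiChebyshev.chebDegree (hφ.isHermitian x) α ε)
    {Ω : Type*} [MeasurableSpace Ω] (P : MeasureTheory.Measure Ω)
    [MeasureTheory.IsProbabilityMeasure P]
    (g : Fin s → Ω → EuclideanSpace ℝ (Fin n))
    (hlaw : ∀ i, ProbabilityTheory.HasLaw (g i)
      (ProbabilityTheory.stdGaussian (EuclideanSpace ℝ (Fin n))) P)
    (hindep : ProbabilityTheory.iIndepFun g P) :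
    1 - δ ≤ P.real {ω |
      0 < RenyiChebyshev.traceEstimate (hφ.isHermitian x) α s m (fun i => g i ω) ∧
      |RenyiChebyshev.entropy (hφ.isHermitian x) α -
          RenyiChebyshev.entropyEstimate (hφ.isHermitian x) α s m (fun i => g i ω)| ≤
        |1 / (1 - α) * Real.logb 2 (1 - 3 * ε)|} :=
  theorem3_general (hφ.posSemidef_normalizedKernelMatrix fun i => (hx i).le)
    (normalizedKernelMatrix_ne_zero hn.ne' hx) hα0 hα1 hε0 hε1 hδ0 hs.ge hm.ge hlaw hindep
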